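/- **Setting.** A database schema has relations $R_1,\dots,R_m$ with finite attribute sets $\mathbb A_1,\dots,\mathbb A_m$, a domain for each attribute, and a (possibly empty) set of foreign keys. A foreign key consists of attributes that the child relation shares with the parent relation and that form a key of the parent. An instance $\mathcal D$ assigns a finite bag of tuples to each relation. It is *valid* if for each foreign key the referenced attributes are a key of the parent (at most one parent tuple, counted with multiplicity, per key value) and every child tuple refers to an existing parent tuple. One relation $P$ is the *primary private relation*. Valid $\mathcal D$ and $\mathcal D'$ are *neighbours* if one arises from the other by deleting one tuple $t$ of $P$ together with all tuples that depend on $t$, directly or transitively, through foreign keys. Without foreign keys this means deleting one tuple of $P$. A randomized mechanism $\mathcal M$ is *$\epsilon$-DP* if $\Pr[\mathcal M(\mathcal D)\in O]\le e^{\epsilon}\Pr[\mathcal M(\mathcal D')\in O]$ for all neighbours $\mathcal D,\mathcal D'$ (in both orders) and all measurable sets $O$. $Lap(b)$ denotes the Laplace distribution with mean $0$ and density $\frac1{2b}e^{-|x|/b}$, and all noises below are independent. $Q$ is a full conjunctive query without self-joins: the natural join $R_1\Join\cdots\Join R_m$ in bag semantics, each relation used once, possibly with a selection condition on the single tuples of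 each relation. In numerical expressions $Q(\mathcal D)$ stands for the number of output tuples. For a tuple $t$ from the domain of a relation let $$TSens(t,Q,\mathcal D)=\max\big(|Q(\mathcal D\cup\{t\})\,\Delta\,Q(\mathcal D)|,\ |Q(\mathcal D)\,\Delta\,Q(\mathcal D\setminus\{t\})|\big),$$ where one copy of $t$ is added or removed and $\Delta$ is the symmetric difference of bags. For $i\in\mathbb N$ let $T_{TSens}(Q,\mathcal D,i)$ be $\mathcal D$ with all tuples $t$ of $P$ such that $TSens(t,Q,\mathcal D)>i$ removed. **Algorithm.** Parameters: integers $\ell\ge1$ and $\tau_0\ge 1$ (for instance $\tau_0=\ell$), and reals $\epsilon_1,\epsilon_2,\epsilon_3>0$ with $\epsilon_1+\epsilon_2+\epsilon_3=\epsilon_{tsens}<\epsilon$. 1. Release $\hat Q=Q(T_{TSens}(Q,\mathcal D,\ell))+Lap(\ell/\epsilon_1)$. 2. (Sparse vector technique.) Put $q_i=\big(Q(T_{TSens}(Q,\mathcal D,i))-\hat Q\big)/i$ for $i=1,\dots,\ell-1$. Draw $\rho\sim Lap(1/\epsilon_2)$. For $i=1,\dots,\ell-1$ in this order draw a fresh $\nu_i\sim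 Lap(2/\epsilon_3)$, and stop at the first $i$ with $q_i+\nu_i>0+\rho$. Let $\tau$ be this $i$, or $\tau_0$ if there is none. 3. Release $Q(T_{TSens}(Q,\mathcal D,\tau))+Lap\big(\frac{\tau}{\epsilon-\epsilon_{tsens}}\big)$. **Theorem.** For every schema, every choice of the primary private relation $P$, every such query $Q$ and all such parameters: (a) the algorithm that finds the truncation threshold (steps 1 and 2) satisfies $\epsilon_{tsens}$-DP, both when it outputs $(\hat Q,\tau)$ and when it outputs $\tau$ alone; (b) for every fixed integer $\tau\ge1$, releasing $Q(T_{TSens}(Q,\mathcal D,\tau))+Lap\big(\frac{\tau}{\epsilon-\epsilon_{tsens}}\big)$ satisfies $(\epsilon-\epsilon_{tsens})$-DP; (c) the whole mechanism (steps 1 to 3) satisfies $\epsilon$-DP, both when it outputs $\hat Q$, $\tau$ and the noisy answer and when it outputs the noisy answer alone. -/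

import Mathlib

open MeasureTheory

/-! ### Relational databases, keys and foreign keys -/

/-- A foreign key of relation `child` into relation `parent`: the attributes `key`, which the two
relations share, form a key of `parent`, and every `child` tuple refers through them to a
`parent` tuple. -/
structure ForeignKey {Attr : Type*} {Rel : Type*} (attrs : Rel → Finset Attr) where
  child : Rel
  parent : Rel
  key : Finset Attr
  key_child : key ⊆ attrs child
  key_parent : key ⊆ attrs parent

/-- A database schema: finitely many relation names, the finite attribute set of each of them, a
domain for each attribute, and a (possibly empty) set of foreign keys. -/
structure Schema where
  Attr : Type*
  Rel : Type*
  [relFintype : Fintype Rel]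
  dom : Attr → Type*
  attrs : Rel → Finset Attr
  fks : Set (ForeignKey attrs)

attribute [instance] Schema.relFintype

namespace Schema

/-- The full domain of tuples of the relation `i`. -/
abbrev Tuple (S : Schema) (i : S.Rel) := (a : {a // a ∈ S.attrs i}) → S.dom a

/-- A tuple from the domain of any table, together with the table that it is meant for. -/
abbrev TableTuple (S : Schema) := Σ i : S.Rel, S.Tuple i

/-- Tuples over the set of all attributes that occur in the database. -/
abbrev OutTuple (S : Schema) := (a : {a // ∃ i, a ∈ S.attrs i}) → S.dom a

/-- The restriction of an output tuple to the attributes of the relation `i`. -/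
def proj {S : Schema} (x : S.OutTuple) (i : S.Rel) : S.Tuple i := fun a => x ⟨a.1, i, a.2⟩

/-- A database instance under bag semantics: a finite bag of tuples for each relation. -/
abbrev Database (S : Schema) := (i : S.Rel) → Multiset (S.Tuple i)

end Schema

namespace ForeignKey

variable {S : Schema}

/-- The values of a child tuple in the foreign key attributes. -/
def childKey (f : ForeignKey S.attrs) (v : S.Tuple f.child) : (a : {a // a ∈ f.key}) → S.dom a :=
  fun a => v ⟨a.1, f.key_child a.2⟩

/-- The values of a parent tuple in the referenced key attributes. -/
def parentKey (f : ForeignKey S.attrs) (u : S.Tuple f.parent) : (a : {a // a ∈ f.key}) → S.dom a :=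
  fun a => u ⟨a.1, f.key_parent a.2⟩

end ForeignKey

namespace Schema

variable {S : Schema}

open scoped Classical in
/-- `D` respects the foreign keys: referenced attributes form a key of the parent relation (at most
one tuple, with multiplicity one, for each key value), and no reference dangles. With no foreign
keys, every instance is valid. -/
def Valid (D : S.Database) : Prop :=
  ∀ f ∈ S.fks,
    (∀ k, Multiset.card ((D f.parent).filter (fun u => f.parentKey u = k)) ≤ 1) ∧
    (∀ v ∈ D f.child, ∃ u ∈ D f.parent, f.childKey v = f.parentKey u)

/-- In `D`, the tuple `v` refers directly to the tuple `u` through a foreign key. -/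
def RefersTo (D : S.Database) (v u : S.TableTuple) : Prop :=
  ∃ f ∈ S.fks, ∃ v' ∈ D f.child, ∃ u' ∈ D f.parent,
    v = ⟨f.child, v'⟩ ∧ u = ⟨f.parent, u'⟩ ∧ f.childKey v' = f.parentKey u'

open scoped Classical in
/-- `D ∪ {t}`: one more copy of `t`. -/
noncomputable def insertTuple (D : S.Database) (t : S.TableTuple) : S.Database :=
  Function.update D t.1 (t.2 ::ₘ D t.1)

open scoped Classical in
/-- `D \ {t}`: one copy of `t` fewer (`D` itself if `t` is not in `D`). -/
noncomputable def removeTuple (D : S.Database) (t : S.TableTuple) : S.Database :=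
  Function.update D t.1 ((D t.1).erase t.2)

open scoped Classical in
/-- Deletion of `t` with cascading deletion of all tuples that depend on `t`, directly or
transitively, through foreign keys. -/
noncomputable def cascadeDelete (D : S.Database) (t : S.TableTuple) : S.Database :=
  fun j => (removeTuple D t j).filter (fun v => ¬ Relation.TransGen (RefersTo D) ⟨j, v⟩ t)

end Schema

open Schema

/-! ### Full conjunctive queries without self-joins, and tuple sensitivity -/

/-- A full conjunctive query without self-joins: the natural join of all the relations, each of
them used once, with a selection condition on the tuples of each relation (`fun _ _ => True` for
the plain natural join). -/
structure JoinQuery (S : Schema) where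
  sel : (i : S.Rel) → S.Tuple i → Prop

namespace JoinQuery

variable {S : Schema}

open scoped Classical in
/-- The multiplicity of an output tuple in the join (bag semantics). -/
noncomputable def mult (Q : JoinQuery S) (D : S.Database) (x : S.OutTuple) : ℕ :=
  ∏ i, ((D i).filter (Q.sel i)).count (proj x i)

theorem finite_support_mult (Q : JoinQuery S) (D : S.Database) :
    (Function.support (Q.mult D)).Finite := by
  classical
  have hfin : (Set.univ.pi fun i => {t : S.Tuple i | t ∈ D i}).Finite :=
    Set.Finite.pi fun i => ((D i).toFinset.finite_toSet).subset fun t ht => by simpa using ht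
  refine (hfin.preimage (f := fun (x : S.OutTuple) i => proj x i) ?_).subset ?_
  · intro x _ y _ hxy
    funext a
    obtain ⟨a, i, ha⟩ := a
    exact congrFun (congrFun hxy i) ⟨a, ha⟩
  · intro x hx i _
    have h := (Finset.prod_ne_zero_iff.mp hx) i (Finset.mem_univ i)
    exact (Multiset.mem_filter.mp (Multiset.count_ne_zero.mp h)).1

/-- The query result `Q(D)`, a bag of output tuples. -/
noncomputable def result (Q : JoinQuery S) (D : S.Database) : Multiset S.OutTuple :=
  Finsupp.toMultiset (Finsupp.ofSupportFinite (Q.mult D) (Q.finite_support_mult D))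

/-- The answer of the counting query: the number of output tuples. -/
noncomputable def answer (Q : JoinQuery S) (D : S.Database) : ℕ :=
  Multiset.card (Q.result D)

open scoped Classical in
/-- The size of the symmetric difference of two bags. -/
noncomputable def bagDist {α : Type*} (A B : Multiset α) : ℕ :=
  Multiset.card ((A - B) + (B - A))

/-- Upward tuple sensitivity. -/
noncomputable def tsensUp (Q : JoinQuery S) (D : S.Database) (t : S.TableTuple) : ℕ :=
  bagDist (Q.result (insertTuple D t)) (Q.result D)

/-- Downward tuple sensitivity. -/
noncomputable def tsensDown (Q : JoinQuery S) (D : S.Database) (t : S.TableTuple) : ℕ :=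
  bagDist (Q.result D) (Q.result (removeTuple D t))

/-- Tuple sensitivity. -/
noncomputable def tsens (Q : JoinQuery S) (D : S.Database) (t : S.TableTuple) : ℕ :=
  max (Q.tsensUp D t) (Q.tsensDown D t)

open scoped Classical in
/-- Truncation: from the primary private relation `p`, remove the tuples whose sensitivity
exceeds `i`; leave the other relations alone. -/
noncomputable def truncate (Q : JoinQuery S) (p : S.Rel) (D : S.Database) (i : ℕ) : S.Database :=
  fun j => (D j).filter (fun t => j = p → Q.tsens D ⟨j, t⟩ ≤ i)

end JoinQuery

/-! ### Differential privacy -/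

/-- `M` is a randomized mechanism on databases that is `ε`-differentially private with primary
private relation `p`: neighbours of a valid instance arise by deleting one tuple of `p` with
cascading deletion. The two inequalities say that the log-ratio of the probabilities is at most
`ε` in absolute value. -/
def IsDP {S : Schema} {Ω : Type*} [MeasurableSpace Ω] (p : S.Rel) (ε : ℝ)
    (M : S.Database → Measure Ω) : Prop :=
  (∀ D, IsProbabilityMeasure (M D)) ∧
  ∀ (D : S.Database) (t : S.Tuple p), Valid D → t ∈ D p → ∀ O : Set Ω, MeasurableSet O →
    M D O ≤ ENNReal.ofReal (Real.exp ε) * M (cascadeDelete D ⟨p, t⟩) O ∧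
    M (cascadeDelete D ⟨p, t⟩) O ≤ ENNReal.ofReal (Real.exp ε) * M D O

/-- The Laplace distribution with mean `0` and scale `b > 0`. -/
noncomputable def laplace (b : ℝ) : Measure ℝ :=
  volume.withDensity (fun x => ENNReal.ofReal (1 / (2 * b) * Real.exp (-|x| / b)))

/-- The noisy scan of the sparse vector technique for a given noisy threshold `θ`: go through the
labelled query answers in order, add fresh Laplace noise of scale `s` to each of them, stop at the
first one that is above `θ`, and report its label; report `dflt` if there is none. -/
noncomputable def svtScan (s θ : ℝ) (dflt : ℕ) : List (ℕ × ℝ) → Measure ℕ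
  | [] => Measure.dirac dflt
  | (i, q) :: L =>
      (laplace s).bind (fun ν => if q + ν > θ then Measure.dirac i else svtScan s θ dflt L)

/-- The sparse vector technique with threshold `0`, for queries of sensitivity `1`, stopping at the
first positive report: budget `α` for the threshold and `β` for the queries. -/
noncomputable def svt (α β : ℝ) (dflt : ℕ) (L : List (ℕ × ℝ)) : Measure ℕ :=
  (laplace (1 / α)).bind (fun ρ => svtScan (2 / β) (0 + ρ) dflt L)

/-! ### The truncation mechanism -/

namespace JoinQuery

variable {S : Schema}

/-- `Q(T(D, i)) + Lap(i / δ)`. -/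
noncomputable def noisyTruncated (Q : JoinQuery S) (p : S.Rel) (δ : ℝ) (i : ℕ) (D : S.Database) :
    Measure ℝ :=
  (laplace (i / δ)).map (fun η => (Q.answer (Q.truncate p D i) : ℝ) + η)

/-- The labelled queries `q_i = (Q(T(D, i)) - Qhat) / i` for `i = 1, …, ℓ - 1`. -/
noncomputable def svtQueries (Q : JoinQuery S) (p : S.Rel) (ℓ : ℕ) (D : S.Database) (Qhat : ℝ) :
    List (ℕ × ℝ) :=
  (List.range' 1 (ℓ - 1)).map (fun i => (i, ((Q.answer (Q.truncate p D i) : ℝ) - Qhat) / i))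

/-- The procedure that finds the truncation threshold; it outputs `(Qhat, τ)`. Budget `ε₁` goes to
`Qhat`, and `ε₂`, `ε₃` go to the sparse vector technique. -/
noncomputable def findThreshold (Q : JoinQuery S) (p : S.Rel) (ℓ dflt : ℕ) (ε₁ ε₂ ε₃ : ℝ)
    (D : S.Database) : Measure (ℝ × ℕ) :=
  (Q.noisyTruncated p ε₁ ℓ D).bind (fun Qhat =>
    (svt ε₂ ε₃ dflt (Q.svtQueries p ℓ D Qhat)).map (fun τ => (Qhat, τ)))

/-- The whole mechanism: find `τ`, then answer with the remaining budget `δ`. It outputs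
`(Qhat, τ, noisy answer)`. -/
noncomputable def tsensDP (Q : JoinQuery S) (p : S.Rel) (ℓ dflt : ℕ) (ε₁ ε₂ ε₃ δ : ℝ)
    (D : S.Database) : Measure (ℝ × ℕ × ℝ) :=
  (Q.findThreshold p ℓ dflt ε₁ ε₂ ε₃ D).bind (fun z =>
    (Q.noisyTruncated p δ z.2 D).map (fun r => (z.1, z.2, r)))

end JoinQuery

/-!
Since each relation is used once, the output of the query is additive in the bag of tuples of the
private relation `p`: it is the sum of the contributions of the single tuples, and the tuple
sensitivity of `t` is exactly the contribution of `t`. Truncation at `i` therefore keeps the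
contributions that are at most `i`.

Deleting `t` with its cascade removes the contribution of `t`, changes no contribution of a
surviving tuple, and removes only zero contributions otherwise. The reason is that referenced
attributes are keys: parts of one output tuple refer only to each other, so an output tuple one of
whose parts depends on `t` contains `t` itself. Hence the truncated answer at `i` has sensitivity
at most `i`, each query of the sparse vector technique has sensitivity at most `1`, and Laplace
noise of the given scales pays for these shifts.

For the sparse vector technique, a run with noisy threshold `θ` on one instance is compared with
threshold `θ + 1` on its neighbour: every query that stays below `θ` then stays below `θ + 1`, so
privacy is lost only at the threshold (a shift by `1`) and at the single report above it (a shift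
by at most `2`). Adaptive composition and post-processing do the rest.
-/

/-! ### Max-divergence and composition -/

section GiryMonad

open ProbabilityTheory (Kernel IsSFiniteKernel)

variable {α β Γ : Type*} [MeasurableSpace α] [MeasurableSpace β] [MeasurableSpace Γ]

theorem measurable_kernel_bind (κ : Kernel Γ α) [IsSFiniteKernel κ] {f : Γ → α → Measure β}
    (hf : Measurable (Function.uncurry f)) : Measurable fun c => (κ c).bind (f c) := by
  have hfc (c) : Measurable (f c) := hf.comp measurable_prodMk_left
  refine Measure.measurable_of_measurable_coe _ fun O hO => ?_
  simp only [Measure.bind_apply hO (hfc _).aemeasurable]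
  exact ((Measure.measurable_coe hO).comp hf).lintegral_kernel_prod_right'

theorem measurable_kernel_map (κ : Kernel Γ α) [IsSFiniteKernel κ] {f : Γ → α → β}
    (hf : Measurable (Function.uncurry f)) : Measurable fun c => (κ c).map (f c) := by
  have hfc (c) : Measurable (f c) := hf.comp measurable_prodMk_left
  simp only [← Measure.bind_dirac_eq_map _ (hfc _)]
  exact measurable_kernel_bind κ (Measure.measurable_dirac.comp hf)

theorem bind_ite {μ : Measure α} {P : α → Prop} [DecidablePred P] (hP : MeasurableSet {x | P x})
    (ν η : Measure β) :
    (μ.bind fun x => if P x then ν else η) = μ {x | P x} • ν + μ {x | ¬ P x} • η := by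
  refine Measure.ext fun O hO => ?_
  have hmeas : Measurable fun x => if P x then ν else η :=
    Measurable.ite hP measurable_const measurable_const
  calc (μ.bind fun x => if P x then ν else η) O
      = ∫⁻ x, if P x then ν O else η O ∂μ := by
        rw [Measure.bind_apply hO hmeas.aemeasurable]
        exact lintegral_congr fun x => apply_ite (fun ξ : Measure β => ξ O) _ _ _
    _ = (∫⁻ _ in {x | P x}, ν O ∂μ) + ∫⁻ _ in {x | P x}ᶜ, η O ∂μ := lintegral_piecewise hP _ _
    _ = (μ {x | P x} • ν + μ {x | ¬ P x} • η) O := by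
        rw [setLIntegral_const, setLIntegral_const, mul_comm, mul_comm (η O)]
        rfl

theorem ae_bind_of_ae_ae {μ : Measure α} {κ : α → Measure β} (hκ : Measurable κ) {P : β → Prop}
    (hP : MeasurableSet {y | P y}) (h : ∀ᵐ x ∂μ, ∀ᵐ y ∂κ x, P y) : ∀ᵐ y ∂μ.bind κ, P y := by
  refine (Measure.bind_apply hP.compl hκ.aemeasurable).trans ?_
  exact (lintegral_congr_ae h).trans lintegral_zero

end GiryMonad

/-- The max-divergence of `μ` from `ν` is at most `ε`: every event is at most `exp ε` times as
likely under `μ` as under `ν`. A mechanism is `ε`-differentially private if this holds for its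
outputs on any two neighbours. -/
def MaxDivergenceLE {α : Type*} [MeasurableSpace α] (ε : ℝ) (μ ν : Measure α) : Prop :=
  μ ≤ ENNReal.ofReal (Real.exp ε) • ν

namespace MaxDivergenceLE

variable {α β : Type*} [MeasurableSpace α] [MeasurableSpace β] {ε δ : ℝ} {μ ν ξ : Measure α}

theorem trans (h₁ : MaxDivergenceLE ε μ ν) (h₂ : MaxDivergenceLE δ ν ξ) :
    MaxDivergenceLE (ε + δ) μ ξ := by
  rw [MaxDivergenceLE, Real.exp_add, ENNReal.ofReal_mul (Real.exp_nonneg ε), mul_smul]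
  exact le_trans h₁ (by gcongr; exact h₂)

theorem map (h : MaxDivergenceLE ε μ ν) {f : α → β} (hf : Measurable f) :
    MaxDivergenceLE ε (μ.map f) (ν.map f) :=
  (Measure.map_mono h hf).trans_eq (Measure.map_smul _ _ _)

theorem bind_left (h : MaxDivergenceLE ε μ ν) {κ : α → Measure β} (hκ : Measurable κ) :
    MaxDivergenceLE ε (μ.bind κ) (ν.bind κ) := by
  rw [MaxDivergenceLE, ← Measure.bind_smul]
  refine Measure.le_iff.2 fun O hO => ?_
  rw [Measure.bind_apply hO hκ.aemeasurable, Measure.bind_apply hO hκ.aemeasurable]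
  exact lintegral_mono' h le_rfl

theorem bind_right {κ η : α → Measure β} (hκ : Measurable κ) (hη : Measurable η)
    (h : ∀ᵐ x ∂μ, MaxDivergenceLE ε (κ x) (η x)) :
    MaxDivergenceLE ε (μ.bind κ) (μ.bind η) := by
  refine Measure.le_iff.2 fun O hO => ?_
  rw [Measure.smul_apply, smul_eq_mul, Measure.bind_apply hO hκ.aemeasurable,
    Measure.bind_apply hO hη.aemeasurable, ← lintegral_const_mul' _ _ ENNReal.ofReal_ne_top]
  exact lintegral_mono_ae (h.mono fun x hx => hx O)

end MaxDivergenceLE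

/-- Neighbouring instances with primary private relation `p`: one of them is valid and the other
arises from it by deleting one tuple of `p` with cascading deletion. -/
def Schema.Neighbors {S : Schema} (p : S.Rel) : S.Database → S.Database → Prop :=
  Relation.SymmGen fun D D' => Valid D ∧ ∃ t ∈ D p, D' = cascadeDelete D ⟨p, t⟩

section DifferentialPrivacy

variable {S : Schema} {p : S.Rel} {Ω Ω' : Type*} [MeasurableSpace Ω] [MeasurableSpace Ω'] {ε δ : ℝ}
  {M : S.Database → Measure Ω}

theorem isDP_iff_neighbors : IsDP p ε M ↔ (∀ D, IsProbabilityMeasure (M D)) ∧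
    ∀ D D', Neighbors p D D' → MaxDivergenceLE ε (M D) (M D') := by
  refine and_congr_right fun _ => ⟨fun h => ?_, fun h D t hD ht O _ => ?_⟩
  · rintro D D' (⟨hD, t, ht, rfl⟩ | ⟨hD, t, ht, rfl⟩)
    · exact Measure.le_iff.2 fun O hO => (h D t hD ht O hO).1
    · exact Measure.le_iff.2 fun O hO => (h D' t hD ht O hO).2
  · have hrel : Neighbors p D (cascadeDelete D ⟨p, t⟩) := .inl ⟨hD, t, ht, rfl⟩
    exact ⟨h _ _ hrel O, h _ _ (Or.symm hrel) O⟩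

theorem IsDP.map (hM : IsDP p ε M) {f : Ω → Ω'} (hf : Measurable f) :
    IsDP p ε fun D => (M D).map f := by
  rw [isDP_iff_neighbors] at hM ⊢
  refine ⟨fun D => ?_, fun D D' h => (hM.2 D D' h).map hf⟩
  have := hM.1 D
  exact Measure.isProbabilityMeasure_map hf.aemeasurable

theorem IsDP.bind (hM : IsDP p ε M) {κ : S.Database → Ω → Measure Ω'}
    (hκ : ∀ D, Measurable (κ D)) {s : Set Ω} (hs : ∀ D, ∀ᵐ z ∂M D, z ∈ s)
    (hDP : ∀ z ∈ s, IsDP p δ fun D => κ D z) : IsDP p (ε + δ) fun D => (M D).bind (κ D) := by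
  rw [isDP_iff_neighbors] at hM ⊢
  simp only [isDP_iff_neighbors] at hDP
  refine ⟨fun D => ?_, fun D D' h => ?_⟩
  · have := hM.1 D
    exact isProbabilityMeasure_bind (hκ D).aemeasurable
      ((hs D).mono fun z hz => (hDP z hz).1 D)
  · rw [add_comm]
    exact (MaxDivergenceLE.bind_right (hκ D) (hκ D')
      ((hs D).mono fun z hz => (hDP z hz).2 D D' h)).trans ((hM.2 D D' h).bind_left (hκ D'))

end DifferentialPrivacy

/-! ### Laplace noise -/

section Laplace

theorem integral_laplace_density {b : ℝ} (hb : 0 < b) :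
    ∫ x : ℝ, 1 / (2 * b) * Real.exp (-|x| / b) = 1 := by
  have hhalf : ∫ x in Set.Ioi (0 : ℝ), Real.exp (-x / b) = b := by
    have h := integral_exp_mul_Ioi (a := -b⁻¹) (by simpa using hb) 0
    simp only [mul_zero, Real.exp_zero] at h
    simpa [div_eq_inv_mul] using h
  rw [integral_const_mul, integral_comp_abs (f := fun x => Real.exp (-x / b)), hhalf,
    one_div_mul_cancel (by positivity)]

theorem isProbabilityMeasure_laplace {b : ℝ} (hb : 0 < b) : IsProbabilityMeasure (laplace b) := by
  have hint := integral_laplace_density hb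
  refine ⟨?_⟩
  rw [laplace, withDensity_apply _ MeasurableSet.univ, setLIntegral_univ,
    ← ofReal_integral_eq_lintegral_ofReal (integrable_of_integral_eq_one hint)
      (Filter.Eventually.of_forall fun x => by positivity), hint, ENNReal.ofReal_one]

instance sFinite_laplace (b : ℝ) : SFinite (laplace b) := by
  unfold laplace
  infer_instance

theorem map_const_add_laplace_eq_withDensity (u b : ℝ) : (laplace b).map (fun x => u + x) =
    volume.withDensity fun x => ENNReal.ofReal (1 / (2 * b) * Real.exp (-|x - u| / b)) := by
  refine Measure.ext fun O hO => ?_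
  rw [Measure.map_apply (measurable_const_add u) hO, laplace,
    withDensity_apply _ (measurable_const_add u hO), withDensity_apply _ hO,
    ← (measurePreserving_add_left volume u).setLIntegral_comp_preimage hO (by fun_prop)]
  simp only [add_sub_cancel_left]

theorem maxDivergenceLE_map_const_add_laplace {u v b c : ℝ} (hb : 0 < b) (h : |u - v| ≤ c * b) :
    MaxDivergenceLE c ((laplace b).map fun x => u + x) ((laplace b).map fun x => v + x) := by
  rw [MaxDivergenceLE, map_const_add_laplace_eq_withDensity,
    map_const_add_laplace_eq_withDensity,
    ← withDensity_smul' _ _ ENNReal.ofReal_ne_top]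
  refine withDensity_mono (Filter.Eventually.of_forall fun x => ?_)
  have hexp : -|x - u| / b ≤ c + -|x - v| / b := by
    have htriangle := abs_sub_le x u v
    rw [div_le_iff₀ hb, add_mul, div_mul_cancel₀ _ hb.ne']
    linarith
  rw [Pi.smul_apply, smul_eq_mul, ← ENNReal.ofReal_mul (Real.exp_nonneg c), mul_left_comm,
    ← Real.exp_add]
  exact ENNReal.ofReal_le_ofReal
    (mul_le_mul_of_nonneg_left (Real.exp_le_exp.2 hexp) (by positivity))

theorem laplace_Ioi_le {a a' b c : ℝ} (hb : 0 < b) (h : |a - a'| ≤ c * b) :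
    laplace b (Set.Ioi a) ≤ ENNReal.ofReal (Real.exp c) * laplace b (Set.Ioi a') := by
  have hshift (t : ℝ) : ((laplace b).map fun x => -t + x) (Set.Ioi 0) = laplace b (Set.Ioi t) := by
    rw [Measure.map_apply (measurable_const_add _) measurableSet_Ioi,
      Set.preimage_const_add_Ioi, sub_neg_eq_add, zero_add]
  rw [← hshift, ← hshift]
  refine maxDivergenceLE_map_const_add_laplace hb ?_ _
  rwa [neg_sub_neg, abs_sub_comm]

theorem isDP_map_add_laplace {S : Schema} {p : S.Rel} {f : S.Database → ℝ} {ε b : ℝ} (hb : 0 < b)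
    (hf : ∀ D D', Neighbors p D D' → |f D - f D'| ≤ ε * b) :
    IsDP p ε fun D => (laplace b).map fun x => f D + x := by
  have := isProbabilityMeasure_laplace hb
  exact isDP_iff_neighbors.2
    ⟨fun D => Measure.isProbabilityMeasure_map (measurable_const_add _).aemeasurable,
      fun D D' h => maxDivergenceLE_map_const_add_laplace hb (hf D D' h)⟩

end Laplace

/-! ### Privacy of the sparse vector technique -/

section SparseVector

theorem svtScan_cons (s θ : ℝ) (dflt i : ℕ) (q : ℝ) (L : List (ℕ × ℝ)) :
    svtScan s θ dflt ((i, q) :: L) = laplace s (Set.Ioi (θ - q)) • Measure.dirac i +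
      laplace s (Set.Iic (θ - q)) • svtScan s θ dflt L := by
  simp only [svtScan, gt_iff_lt, ← sub_lt_iff_lt_add']
  rw [bind_ite measurableSet_Ioi]
  simp only [not_lt]
  rfl

section Measurability

variable {Γ ι : Type*} [MeasurableSpace Γ] {q : ι → Γ → ℝ} (label : ι → ℕ)

theorem measurable_svtScan (s : ℝ) {θ : Γ → ℝ} (hθ : Measurable θ) (dflt : ℕ)
    (hq : ∀ j, Measurable (q j)) (L : List ι) :
    Measurable fun z => svtScan s (θ z) dflt (L.map fun j => (label j, q j z)) := by
  induction L with
  | nil => exact measurable_const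
  | cons j L ih =>
    exact measurable_kernel_bind (ProbabilityTheory.Kernel.const Γ (laplace s)) <| Measurable.ite
      (measurableSet_lt (hθ.comp measurable_fst) (((hq j).comp measurable_fst).add measurable_snd))
      measurable_const (ih.comp measurable_fst)

theorem measurable_svtScan_threshold (s : ℝ) (dflt : ℕ) (L : List (ℕ × ℝ)) :
    Measurable fun θ => svtScan s θ dflt L := by
  simpa using measurable_svtScan Prod.fst s measurable_id' dflt
    (fun e : ℕ × ℝ => measurable_const (a := e.2)) L

theorem measurable_svt (α β : ℝ) (dflt : ℕ) (hq : ∀ j, Measurable (q j)) (L : List ι) :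
    Measurable fun z => svt α β dflt (L.map fun j => (label j, q j z)) :=
  measurable_kernel_bind (ProbabilityTheory.Kernel.const Γ (laplace (1 / α))) <|
    measurable_svtScan label (2 / β) (measurable_snd.const_add 0) dflt
      (fun j => (hq j).comp measurable_fst) L

end Measurability

theorem isProbabilityMeasure_svtScan {s : ℝ} (hs : 0 < s) (θ : ℝ) (dflt : ℕ) (L : List (ℕ × ℝ)) :
    IsProbabilityMeasure (svtScan s θ dflt L) := by
  have := isProbabilityMeasure_laplace hs
  induction L with
  | nil => exact Measure.dirac.isProbabilityMeasure
  | cons e L ih =>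
    refine ⟨?_⟩
    rw [svtScan_cons, Measure.add_apply, Measure.smul_apply, Measure.smul_apply, measure_univ,
      measure_univ, smul_eq_mul, smul_eq_mul, mul_one, mul_one, ← Set.compl_Ioi]
    exact prob_add_prob_compl measurableSet_Ioi

theorem isProbabilityMeasure_svt {α β : ℝ} (hα : 0 < α) (hβ : 0 < β) (dflt : ℕ)
    (L : List (ℕ × ℝ)) : IsProbabilityMeasure (svt α β dflt L) := by
  have := isProbabilityMeasure_laplace (one_div_pos.2 hα)
  refine isProbabilityMeasure_bind
    ((measurable_svtScan_threshold _ _ _).comp (measurable_const_add 0)).aemeasurable ?_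
  exact .of_forall fun ρ => isProbabilityMeasure_svtScan (by positivity) _ _ _

theorem ae_svtScan_mem (s θ : ℝ) (dflt : ℕ) (L : List (ℕ × ℝ)) :
    ∀ᵐ i ∂svtScan s θ dflt L, i ∈ dflt :: L.map Prod.fst := by
  induction L with
  | nil => simp [svtScan, ae_dirac_eq]
  | cons e L ih =>
    rw [svtScan_cons, ae_add_measure_iff]
    refine ⟨Measure.ae_smul_measure (by simp [ae_dirac_eq]) _,
      Measure.ae_smul_measure (ih.mono fun i hi => ?_) _⟩
    simp only [List.map_cons, List.mem_cons] at hi ⊢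
    tauto

theorem ae_svt_mem (α β : ℝ) (dflt : ℕ) (L : List (ℕ × ℝ)) :
    ∀ᵐ i ∂svt α β dflt L, i ∈ dflt :: L.map Prod.fst :=
  ae_bind_of_ae_ae ((measurable_svtScan_threshold _ _ _).comp (measurable_const_add 0)) .of_discrete
    (.of_forall fun _ => ae_svtScan_mem _ _ _ _)

/-- Two lists of labelled query answers with the same labels whose corresponding answers differ by
at most `1`: the answers of queries of sensitivity `1` on two neighbours. -/
def UnitSensitive : List (ℕ × ℝ) → List (ℕ × ℝ) → Prop :=
  List.Forall₂ fun e e' => e.1 = e'.1 ∧ |e.2 - e'.2| ≤ 1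

/-- With the threshold raised by `1`, no prefix of the queries is less likely to stay below it, so
only the one report above the threshold is charged, for a shift of its noise by at most `2`. -/
theorem maxDivergenceLE_svtScan {β : ℝ} (hβ : 0 < β) (θ : ℝ) (dflt : ℕ) {L L' : List (ℕ × ℝ)}
    (h : UnitSensitive L L') :
    MaxDivergenceLE β (svtScan (2 / β) θ dflt L) (svtScan (2 / β) (θ + 1) dflt L') := by
  induction h with
  | nil =>
    refine Measure.le_iff.2 fun O _ => ?_
    exact le_mul_of_one_le_left zero_le (ENNReal.one_le_ofReal.2 (Real.one_le_exp hβ.le))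
  | @cons e e' L L' he _ ih =>
    obtain ⟨i, q⟩ := e
    obtain ⟨i', q'⟩ := e'
    obtain ⟨rfl, hq⟩ : i = i' ∧ |q - q'| ≤ 1 := he
    rw [abs_le] at hq
    have hreport := laplace_Ioi_le (a := θ - q) (a' := θ + 1 - q') (b := 2 / β) (c := β)
      (by positivity) (by rw [mul_div_cancel₀ _ hβ.ne', abs_le]; constructor <;> linarith)
    have hpass : laplace (2 / β) (Set.Iic (θ - q)) ≤ laplace (2 / β) (Set.Iic (θ + 1 - q')) :=
      measure_mono (Set.Iic_subset_Iic.2 (by linarith))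
    rw [MaxDivergenceLE, svtScan_cons, svtScan_cons, smul_add, smul_smul, smul_comm]
    gcongr
    exact ih

theorem maxDivergenceLE_svt {α β : ℝ} (hα : 0 < α) (hβ : 0 < β) (dflt : ℕ) {L L' : List (ℕ × ℝ)}
    (h : UnitSensitive L L') :
    MaxDivergenceLE (α + β) (svt α β dflt L) (svt α β dflt L') := by
  have hmeas := measurable_svtScan_threshold (2 / β) dflt L'
  have hthreshold : MaxDivergenceLE α ((laplace (1 / α)).map fun ρ => 1 + ρ) (laplace (1 / α)) := by
    simpa using maxDivergenceLE_map_const_add_laplace (u := 1) (v := 0) (one_div_pos.2 hα)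
      (by simp [hα.ne'])
  have hshift : (laplace (1 / α)).bind (fun ρ => svtScan (2 / β) (ρ + 1) dflt L') =
      ((laplace (1 / α)).map fun ρ => 1 + ρ).bind fun ρ => svtScan (2 / β) ρ dflt L' := by
    rw [Measure.bind, Measure.bind, Measure.map_map hmeas (measurable_const_add 1)]
    simp only [Function.comp_def, add_comm]
  simp only [svt, zero_add]
  rw [add_comm]
  refine .trans ?_ (hthreshold.bind_left hmeas)
  rw [← hshift]
  exact .bind_right (measurable_svtScan_threshold _ _ _) (hmeas.comp (measurable_add_const 1))
    (.of_forall fun ρ => maxDivergenceLE_svtScan hβ ρ dflt h)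

theorem isDP_svt {S : Schema} {p : S.Rel} {α β : ℝ} (hα : 0 < α) (hβ : 0 < β) (dflt : ℕ)
    {L : S.Database → List (ℕ × ℝ)} (hL : ∀ D D', Neighbors p D D' → UnitSensitive (L D) (L D')) :
    IsDP p (α + β) fun D => svt α β dflt (L D) :=
  isDP_iff_neighbors.2 ⟨fun _ => isProbabilityMeasure_svt hα hβ _ _,
    fun D D' h => maxDivergenceLE_svt hα hβ dflt (hL D D' h)⟩

end SparseVector

/-! ### Sensitivity of the truncated answer -/

namespace Schema

variable {S : Schema} {D : S.Database} {p : S.Rel}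

/-- The tuple `v` depends on `u`, directly or transitively, through the foreign keys: these are the
tuples that the deletion of `u` takes along. -/
abbrev DependsOn (D : S.Database) : S.TableTuple → S.TableTuple → Prop :=
  Relation.TransGen (RefersTo D)

open scoped Classical in
theorem Valid.notMem_erase_of_parentKey_eq (hD : Valid D) {f : ForeignKey S.attrs} (hf : f ∈ S.fks)
    {u u' : S.Tuple f.parent} (hu : u ∈ D f.parent) (hkey : f.parentKey u' = f.parentKey u) :
    u' ∉ (D f.parent).erase u := by
  intro hu'
  have hunique := (hD f hf).1 (f.parentKey u)
  rw [← Multiset.cons_erase hu, ← Multiset.cons_erase hu'] at hunique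
  simp [hkey] at hunique

theorem Valid.proj_eq_of_refersTo (hD : Valid D) {x : S.OutTuple} (hx : ∀ i, proj x i ∈ D i)
    {v u : S.TableTuple} (h : RefersTo D v u) (hv : v.2 = proj x v.1) : u.2 = proj x u.1 := by
  obtain ⟨f, hf, v, -, u, hu, rfl, rfl, hkey⟩ := h
  obtain rfl : v = proj x f.child := hv
  by_contra hne
  classical
  exact hD.notMem_erase_of_parentKey_eq hf hu (u' := proj x f.parent) hkey
    ((Multiset.mem_erase_of_ne (Ne.symm hne)).2 (hx f.parent))

theorem Valid.proj_eq_of_dependsOn (hD : Valid D) {x : S.OutTuple} (hx : ∀ i, proj x i ∈ D i)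
    {v u : S.TableTuple} (h : DependsOn D v u) (hv : v.2 = proj x v.1) : u.2 = proj x u.1 := by
  induction h with
  | single h => exact hD.proj_eq_of_refersTo hx h hv
  | tail _ h ih => exact hD.proj_eq_of_refersTo hx h ih

open scoped Classical in
theorem Valid.notMem_erase_of_dependsOn (hD : Valid D) {v : S.TableTuple} {t : S.Tuple p}
    (h : DependsOn D v ⟨p, t⟩) : t ∉ (D p).erase t := by
  obtain ⟨_, -, f, hf, _, -, u, hu, -, heq, -⟩ := Relation.TransGen.tail'_iff.1 h
  obtain ⟨rfl, hut⟩ := Sigma.mk.inj_iff.1 heq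
  obtain rfl := eq_of_heq hut
  exact hD.notMem_erase_of_parentKey_eq hf hu rfl

open scoped Classical in
/-- An output tuple that does not use the deleted copy of `t` survives the cascade: the parts of an
output tuple refer only to each other, so a part depending on `t` would force `t` itself to be a
part, in a second copy, and referenced tuples have no second copy. -/
theorem Valid.not_dependsOn_of_mem_erase (hD : Valid D) {x : S.OutTuple}
    (hx : ∀ i, proj x i ∈ D i) {t : S.Tuple p} (hp : proj x p ∈ (D p).erase t) (i : S.Rel) :
    ¬ DependsOn D ⟨i, proj x i⟩ ⟨p, t⟩ := by
  intro h
  obtain rfl : t = proj x p := hD.proj_eq_of_dependsOn hx h rfl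
  exact hD.notMem_erase_of_dependsOn h hp

open scoped Classical in
theorem cascadeDelete_self (D : S.Database) (t : S.Tuple p) :
    cascadeDelete D ⟨p, t⟩ p =
      ((D p).erase t).filter fun v => ¬ DependsOn D ⟨p, v⟩ ⟨p, t⟩ := by
  simp [cascadeDelete, removeTuple]

open scoped Classical in
theorem cascadeDelete_of_ne (D : S.Database) (t : S.Tuple p) {i : S.Rel} (hi : i ≠ p) :
    cascadeDelete D ⟨p, t⟩ i = (D i).filter fun v => ¬ DependsOn D ⟨i, v⟩ ⟨p, t⟩ := by
  simp [cascadeDelete, removeTuple, hi]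

end Schema

namespace JoinQuery

variable {S : Schema} {D : S.Database} {p : S.Rel} (Q : JoinQuery S)

open scoped Classical in
theorem count_result (D : S.Database) (x : S.OutTuple) : (Q.result D).count x = Q.mult D x :=
  Finsupp.count_toMultiset _ _

theorem mult_mono {D D' : S.Database} (h : D ≤ D') (x : S.OutTuple) : Q.mult D x ≤ Q.mult D' x := by
  classical
  exact Finset.prod_le_prod' fun i _ =>
    Multiset.count_le_of_le _ (Multiset.filter_le_filter _ (h i))

open scoped Classical in
theorem mult_congr {D D' : S.Database} {x : S.OutTuple}
    (h : ∀ i, (D i).count (proj x i) = (D' i).count (proj x i)) : Q.mult D x = Q.mult D' x := by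
  simp only [mult, Multiset.count_filter, h]

theorem proj_mem_of_mult_ne_zero {x : S.OutTuple} (h : Q.mult D x ≠ 0) (i : S.Rel) :
    proj x i ∈ D i := by
  classical
  exact Multiset.mem_of_mem_filter
    (Multiset.count_ne_zero.1 (Finset.prod_ne_zero_iff.1 h i (Finset.mem_univ i)))

open scoped Classical in
theorem proj_mem_of_mult_update_singleton_ne_zero {s : S.Tuple p} (hs : s ∈ D p) {x : S.OutTuple}
    (h : Q.mult (Function.update D p {s}) x ≠ 0) : proj x p = s ∧ ∀ i, proj x i ∈ D i := by
  have hmem := Q.proj_mem_of_mult_ne_zero h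
  obtain rfl : proj x p = s := by simpa using hmem p
  refine ⟨rfl, fun i => ?_⟩
  rcases eq_or_ne i p with rfl | hi
  · exact hs
  · simpa [hi] using hmem i

open scoped Classical in
theorem mult_update (D : S.Database) (B : Multiset (S.Tuple p)) (x : S.OutTuple) :
    Q.mult (Function.update D p B) x = (B.filter (Q.sel p)).count (proj x p) *
      ∏ i ∈ Finset.univ.erase p, ((D i).filter (Q.sel i)).count (proj x i) := by
  rw [mult, ← Finset.mul_prod_erase _ _ (Finset.mem_univ p), Function.update_self]
  congr 1
  refine Finset.prod_congr rfl fun i hi => ?_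
  rw [Function.update_of_ne (Finset.ne_of_mem_erase hi)]

open scoped Classical in
theorem result_update_add (D : S.Database) (B C : Multiset (S.Tuple p)) :
    Q.result (Function.update D p (B + C)) =
      Q.result (Function.update D p B) + Q.result (Function.update D p C) := by
  ext x
  simp only [Multiset.count_add, count_result, mult_update, Multiset.filter_add, add_mul]

open scoped Classical in
/-- The number of output tuples that a single copy of the tuple `t` of the relation `p` produces
together with the other relations of `D`; it does not depend on the bag `D p`. -/
noncomputable def contribution (p : S.Rel) (D : S.Database) (t : S.Tuple p) : ℕ :=
  Q.answer (Function.update D p {t})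

open scoped Classical in
theorem answer_update (D : S.Database) (B : Multiset (S.Tuple p)) :
    Q.answer (Function.update D p B) = (B.map (Q.contribution p D)).sum := by
  induction B using Multiset.induction with
  | empty => simpa [answer] using Q.result_update_add D (0 : Multiset (S.Tuple p)) 0
  | cons t B ih =>
    rw [Multiset.map_cons, Multiset.sum_cons, ← ih, ← Multiset.singleton_add, answer,
      result_update_add, Multiset.card_add]
    rfl

theorem bagDist_add_left {α : Type*} (A B : Multiset α) :
    bagDist (A + B) B = Multiset.card A := by
  classical
  have hle : B - (A + B) = 0 := tsub_eq_zero_of_le (Multiset.le_add_left B A)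
  unfold bagDist
  convert congrArg Multiset.card (show A + B - B + (B - (A + B)) = A by simp [hle])

theorem bagDist_self {α : Type*} (A : Multiset α) : bagDist A A = 0 := by
  simpa using bagDist_add_left 0 A

theorem tsensUp_eq_contribution (D : S.Database) (t : S.Tuple p) :
    Q.tsensUp D ⟨p, t⟩ = Q.contribution p D t := by
  classical
  rw [tsensUp, insertTuple, ← Multiset.singleton_add, result_update_add, Function.update_eq_self,
    bagDist_add_left]
  rfl

theorem tsensDown_le_contribution (D : S.Database) (t : S.Tuple p) :
    Q.tsensDown D ⟨p, t⟩ ≤ Q.contribution p D t := by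
  classical
  rw [tsensDown, removeTuple]
  by_cases ht : t ∈ D p
  · have hsplit : Q.result D = Q.result (Function.update D p {t}) +
        Q.result (Function.update D p ((D p).erase t)) := by
      rw [← result_update_add, Multiset.singleton_add, Multiset.cons_erase ht,
        Function.update_eq_self]
    refine (congrArg (bagDist · _) hsplit).trans_le ?_
    exact (bagDist_add_left _ _).le
  · simp [Multiset.erase_of_notMem ht, bagDist_self]

theorem tsens_eq_contribution (D : S.Database) (t : S.Tuple p) :
    Q.tsens D ⟨p, t⟩ = Q.contribution p D t := by
  rw [tsens, tsensUp_eq_contribution, max_eq_left (Q.tsensDown_le_contribution D t)]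

theorem answer_truncate (p : S.Rel) (D : S.Database) (i : ℕ) :
    Q.answer (Q.truncate p D i) = (((D p).map (Q.contribution p D)).filter (· ≤ i)).sum := by
  classical
  have htruncate : Q.truncate p D i =
      Function.update D p ((D p).filter fun t => Q.contribution p D t ≤ i) := by
    funext j
    by_cases hj : j = p
    · subst hj
      simp [truncate, tsens_eq_contribution]
    · simp [truncate, hj]
  rw [htruncate, answer_update, Multiset.filter_map]
  rfl

open scoped Classical in
theorem mult_update_cascadeDelete (hD : Valid D) {t s : S.Tuple p} (hs : s ∈ (D p).erase t)
    (x : S.OutTuple) : Q.mult (Function.update (cascadeDelete D ⟨p, t⟩) p {s}) x =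
      Q.mult (Function.update D p {s}) x := by
  have hle : Function.update (cascadeDelete D ⟨p, t⟩) p {s} ≤ Function.update D p {s} :=
    update_le_update_iff.2 ⟨le_rfl, fun i hi => by
      rw [cascadeDelete_of_ne D t hi]; exact Multiset.filter_le _ _⟩
  rcases eq_or_ne (Q.mult (Function.update D p {s}) x) 0 with hzero | hpos
  · exact le_antisymm (Q.mult_mono hle x) (hzero ▸ Nat.zero_le _)
  · obtain ⟨rfl, hmem⟩ :=
      Q.proj_mem_of_mult_update_singleton_ne_zero (Multiset.mem_of_mem_erase hs) hpos
    refine Q.mult_congr fun i => ?_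
    rcases eq_or_ne i p with rfl | hi
    · simp only [Function.update_self]
    · rw [Function.update_of_ne hi, Function.update_of_ne hi, cascadeDelete_of_ne D t hi]
      exact Multiset.count_filter_of_pos (hD.not_dependsOn_of_mem_erase hmem hs i)

open scoped Classical in
theorem contribution_cascadeDelete (hD : Valid D) {t s : S.Tuple p} (hs : s ∈ (D p).erase t) :
    Q.contribution p (cascadeDelete D ⟨p, t⟩) s = Q.contribution p D s := by
  refine congrArg Multiset.card (Multiset.ext.2 fun x => ?_)
  rw [count_result, count_result, Q.mult_update_cascadeDelete hD hs]

open scoped Classical in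
theorem contribution_eq_zero_of_dependsOn (hD : Valid D) {t s : S.Tuple p}
    (hs : s ∈ (D p).erase t) (h : DependsOn D ⟨p, s⟩ ⟨p, t⟩) : Q.contribution p D s = 0 := by
  refine Multiset.card_eq_zero.2 (Multiset.eq_zero_iff_forall_notMem.2 fun x hx => ?_)
  rw [← Multiset.count_ne_zero, count_result] at hx
  obtain ⟨rfl, hmem⟩ :=
    Q.proj_mem_of_mult_update_singleton_ne_zero (Multiset.mem_of_mem_erase hs) hx
  exact hD.not_dependsOn_of_mem_erase hmem hs p h

theorem map_contribution_eq_cons (hD : Valid D) {t : S.Tuple p} (ht : t ∈ D p) :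
    ∃ n, (D p).map (Q.contribution p D) = Q.contribution p D t ::ₘ
      ((cascadeDelete D ⟨p, t⟩ p).map (Q.contribution p (cascadeDelete D ⟨p, t⟩)) +
        Multiset.replicate n 0) := by
  classical
  set dependent := ((D p).erase t).filter fun s => ¬ ¬ DependsOn D ⟨p, s⟩ ⟨p, t⟩
  have hsplit : D p = t ::ₘ (cascadeDelete D ⟨p, t⟩ p + dependent) := by
    rw [cascadeDelete_self, Multiset.filter_add_not, Multiset.cons_erase ht]
  have hsurviving : (cascadeDelete D ⟨p, t⟩ p).map (Q.contribution p (cascadeDelete D ⟨p, t⟩)) =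
      (cascadeDelete D ⟨p, t⟩ p).map (Q.contribution p D) := by
    refine Multiset.map_congr rfl fun s hs => Q.contribution_cascadeDelete hD ?_
    rw [cascadeDelete_self] at hs
    exact Multiset.mem_of_mem_filter hs
  have hdependent : dependent.map (Q.contribution p D) =
      Multiset.replicate (Multiset.card dependent) 0 := by
    rw [← Multiset.map_const']
    refine Multiset.map_congr rfl fun s hs => ?_
    obtain ⟨hs, hdep⟩ := Multiset.mem_filter.1 hs
    exact Q.contribution_eq_zero_of_dependsOn hD hs (not_not.1 hdep)
  refine ⟨Multiset.card dependent, ?_⟩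
  rw [hsurviving, ← hdependent, ← Multiset.map_add, ← Multiset.map_cons, ← hsplit]

theorem abs_answer_truncate_cascadeDelete_sub_le (hD : Valid D) {t : S.Tuple p} (ht : t ∈ D p)
    (i : ℕ) : |(Q.answer (Q.truncate p D i) : ℝ) -
      Q.answer (Q.truncate p (cascadeDelete D ⟨p, t⟩) i)| ≤ i := by
  obtain ⟨n, hn⟩ := Q.map_contribution_eq_cons hD ht
  have hzeros : ((Multiset.replicate n 0).filter (· ≤ i)).sum = 0 :=
    Multiset.sum_eq_zero fun c hc => Multiset.eq_of_mem_replicate (Multiset.mem_of_mem_filter hc)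
  rw [answer_truncate, answer_truncate, hn, Multiset.filter_cons, Multiset.filter_add,
    Multiset.sum_add, Multiset.sum_add, hzeros, add_zero, Nat.cast_add, add_sub_cancel_right,
    Nat.abs_cast]
  split_ifs with hle
  · simpa using hle
  · simp

theorem abs_answer_truncate_sub_le {D D' : S.Database} (h : Neighbors p D D') (i : ℕ) :
    |(Q.answer (Q.truncate p D i) : ℝ) - Q.answer (Q.truncate p D' i)| ≤ i := by
  rcases h with ⟨hD, t, ht, rfl⟩ | ⟨hD', t, ht, rfl⟩
  · exact Q.abs_answer_truncate_cascadeDelete_sub_le hD ht i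
  · rw [abs_sub_comm]
    exact Q.abs_answer_truncate_cascadeDelete_sub_le hD' ht i

end JoinQuery

/-! ### Privacy of the truncation mechanism -/

namespace JoinQuery

variable {S : Schema} (Q : JoinQuery S) (p : S.Rel)

theorem isDP_noisyTruncated {δ : ℝ} (hδ : 0 < δ) {i : ℕ} (hi : 1 ≤ i) :
    IsDP p δ (Q.noisyTruncated p δ i) := by
  have hi' : (0 : ℝ) < i := by exact_mod_cast hi
  refine isDP_map_add_laplace (div_pos hi' hδ) fun D D' h => ?_
  rw [mul_div_cancel₀ _ hδ.ne']
  exact Q.abs_answer_truncate_sub_le h i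

theorem unitSensitive_svtQueries (ℓ : ℕ) {D D' : S.Database} (h : Neighbors p D D') (Qhat : ℝ) :
    UnitSensitive (Q.svtQueries p ℓ D Qhat) (Q.svtQueries p ℓ D' Qhat) := by
  rw [UnitSensitive, svtQueries, svtQueries, List.forall₂_map_left_iff, List.forall₂_map_right_iff,
    List.forall₂_same]
  refine fun i _ => ⟨rfl, ?_⟩
  rw [← sub_div, sub_sub_sub_cancel_right, abs_div, Nat.abs_cast]
  exact div_le_one_of_le₀ (Q.abs_answer_truncate_sub_le h i) (Nat.cast_nonneg i)

theorem measurable_map_svt_svtQueries (ℓ dflt : ℕ) {α β : ℝ} (hα : 0 < α) (hβ : 0 < β)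
    (D : S.Database) : Measurable fun Qhat : ℝ =>
      (svt α β dflt (Q.svtQueries p ℓ D Qhat)).map fun τ => (Qhat, τ) := by
  have hsvt : Measurable fun Qhat => svt α β dflt (Q.svtQueries p ℓ D Qhat) :=
    measurable_svt (fun i => i) α β dflt (fun i => by fun_prop) (List.range' 1 (ℓ - 1))
  let κ : ProbabilityTheory.Kernel ℝ ℕ := ⟨_, hsvt⟩
  have : ProbabilityTheory.IsMarkovKernel κ := ⟨fun _ => isProbabilityMeasure_svt hα hβ _ _⟩
  exact measurable_kernel_map κ measurable_id

theorem isDP_findThreshold {ℓ : ℕ} (hℓ : 1 ≤ ℓ) (dflt : ℕ) {ε₁ ε₂ ε₃ : ℝ} (h₁ : 0 < ε₁)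
    (h₂ : 0 < ε₂) (h₃ : 0 < ε₃) :
    IsDP p (ε₁ + ε₂ + ε₃) (Q.findThreshold p ℓ dflt ε₁ ε₂ ε₃) := by
  rw [add_assoc]
  refine (Q.isDP_noisyTruncated p h₁ hℓ).bind (s := Set.univ)
    (Q.measurable_map_svt_svtQueries p ℓ dflt h₂ h₃) (fun _ => .of_forall fun _ => trivial)
    fun Qhat _ => ?_
  exact (isDP_svt h₂ h₃ dflt fun D D' h => Q.unitSensitive_svtQueries p ℓ h Qhat).map
    measurable_prodMk_left

theorem ae_findThreshold_one_le {ℓ dflt : ℕ} (hdflt : 1 ≤ dflt) {ε₁ ε₂ ε₃ : ℝ} (h₂ : 0 < ε₂)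
    (h₃ : 0 < ε₃) (D : S.Database) :
    ∀ᵐ z ∂Q.findThreshold p ℓ dflt ε₁ ε₂ ε₃ D, 1 ≤ z.2 := by
  refine ae_bind_of_ae_ae (Q.measurable_map_svt_svtQueries p ℓ dflt h₂ h₃ D)
    (measurableSet_le measurable_const measurable_snd) (.of_forall fun Qhat => ?_)
  rw [ae_map_iff measurable_prodMk_left.aemeasurable
    (measurableSet_le measurable_const measurable_snd)]
  filter_upwards [ae_svt_mem ε₂ ε₃ dflt (Q.svtQueries p ℓ D Qhat)] with τ hτ
  simp only [svtQueries, List.map_map, Function.comp_def, List.map_id', List.mem_cons,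
    List.mem_range'_1] at hτ
  omega

theorem measurable_map_noisyTruncated (δ : ℝ) (D : S.Database) : Measurable fun z : ℝ × ℕ =>
    (Q.noisyTruncated p δ z.2 D).map fun r => (z.1, z.2, r) := by
  refine measurable_from_prod_countable_left fun τ => ?_
  have : SFinite (Q.noisyTruncated p δ τ D) := by
    unfold noisyTruncated
    infer_instance
  exact measurable_kernel_map (ProbabilityTheory.Kernel.const ℝ (Q.noisyTruncated p δ τ D))
    (measurable_fst.prodMk (measurable_const.prodMk measurable_snd))

theorem isDP_tsensDP {ℓ dflt : ℕ} (hℓ : 1 ≤ ℓ) (hdflt : 1 ≤ dflt) {ε₁ ε₂ ε₃ δ : ℝ} (h₁ : 0 < ε₁)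
    (h₂ : 0 < ε₂) (h₃ : 0 < ε₃) (hδ : 0 < δ) :
    IsDP p (ε₁ + ε₂ + ε₃ + δ) (Q.tsensDP p ℓ dflt ε₁ ε₂ ε₃ δ) :=
  (Q.isDP_findThreshold p hℓ dflt h₁ h₂ h₃).bind (Q.measurable_map_noisyTruncated p δ)
    (s := {z | 1 ≤ z.2}) (Q.ae_findThreshold_one_le p hdflt h₂ h₃)
    fun _ hz => (Q.isDP_noisyTruncated p hδ hz).map (by fun_prop)

end JoinQuery

theorem mainTheorem6 (S : Schema) (Q : JoinQuery S) (p : S.Rel)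
    (ℓ dflt : ℕ) (hℓ : 1 ≤ ℓ) (hdflt : 1 ≤ dflt)
    (ε εtsens ε₁ ε₂ ε₃ : ℝ) (h₁ : 0 < ε₁) (h₂ : 0 < ε₂) (h₃ : 0 < ε₃)
    (hsum : ε₁ + ε₂ + ε₃ = εtsens) (hε : εtsens < ε) :
    -- the search for the threshold, with everything it releases, and its output `τ` alone
    IsDP p εtsens (Q.findThreshold p ℓ dflt ε₁ ε₂ ε₃) ∧
    IsDP p εtsens (fun D => (Q.findThreshold p ℓ dflt ε₁ ε₂ ε₃ D).map (fun z => z.2)) ∧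
    -- the noisy answer for a given threshold
    (∀ τ : ℕ, 1 ≤ τ → IsDP p (ε - εtsens) (Q.noisyTruncated p (ε - εtsens) τ)) ∧
    -- the combined mechanism, with everything it releases, and its final answer alone
    IsDP p ε (Q.tsensDP p ℓ dflt ε₁ ε₂ ε₃ (ε - εtsens)) ∧
    IsDP p ε (fun D => (Q.tsensDP p ℓ dflt ε₁ ε₂ ε₃ (ε - εtsens) D).map (fun z => z.2.2)) := by
  subst hsum
  have hδ : 0 < ε - (ε₁ + ε₂ + ε₃) := sub_pos.2 hε
  have hfind := Q.isDP_findThreshold p hℓ dflt h₁ h₂ h₃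
  have htsensDP := Q.isDP_tsensDP p hℓ hdflt h₁ h₂ h₃ hδ
  rw [add_sub_cancel] at htsensDP
  exact ⟨hfind, hfind.map measurable_snd, fun _ hτ => Q.isDP_noisyTruncated p hδ hτ,
    htsensDP, htsensDP.map measurable_snd.snd⟩
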